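/- Let $a\in\mathbb R$ and let $f$ be a real-valued function of $(x,y)\in\mathbb R^2$, real-analytic near $(0,0)$, with $f(0,0)=f'_y(0,0)=f''_{xy}(0,0)=0$. Consider the analytic saddle-node $$\dot x=x^2,\qquad \dot y=-(1+ax)\,y+f(x,y),$$ and let $$\alpha := a-f'_x(0,0)\,f''_{yy}(0,0)$$ be its formal invariant, that is, the number for which $-(1+ax)+f'_y(x,\phi(x))=-(1+\alpha x)+O(x^2)$ along the formal center manifold $y=\phi(x)=f'_x(0,0)x+O(x^2)$. (Thus $\alpha=a$ exactly when $f'_x(0,0)f''_{yy}(0,0)=0$.) Then there is a unique formal series $\phi=\sum_{n\ge1}\phi_nx^n\in x\,\mathbb C[[x]]$ (the formal series expansion of the center manifold) that satisfies $$x^2\phi'(x)=-(1+ax)\,\phi(x)+f(x,\phi(x))\quad\text{in }\mathbb C[[x]],$$ where $f$ is replaced by its Taylor series at the origin, and there is a number $S_\infty\in\mathbb R$ such that $$\frac{(-1)^n\phi_n}{\Gamma(n+\alpha)}\longrightarrow S_\infty\qquad\text{as } n\to\infty .$$ In particular, if $f'_x(0,0)f''_{yy}(0,0)=0$, then $(-1)^n\phi_n/\Gamma(n+a)\to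 S_\infty$. -/

import Mathlib

open Filter Topology PowerSeries

/-- The Taylor coefficient of the monomial `x ^ j * y ^ k` at the origin of a function
`f (x, y)` of two real variables: `(∂_x ^ j ∂_y ^ k f) (0, 0) / (j! k!)`. -/
noncomputable def taylorCoeff₂ (f : ℝ × ℝ → ℝ) (j k : ℕ) : ℝ :=
  iteratedDeriv j (fun x => iteratedDeriv k (fun y => f (x, y)) 0) 0 /
    ((j.factorial : ℝ) * (k.factorial : ℝ))

/-- The Taylor series of `f (x, y)` at the origin, as a formal power series with complex
coefficients in two variables (variable `0` is `x`, variable `1` is `y`). -/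
noncomputable def taylorSeries₂ (f : ℝ × ℝ → ℝ) : MvPowerSeries (Fin 2) ℂ :=
  fun m => (taylorCoeff₂ f (m 0) (m 1) : ℂ)

/-- `φ ∈ x ℂ⟦x⟧` is a formal series expansion of the center manifold `y = φ(x)` of
`ẋ = x ^ 2`, `ẏ = -(1 + a x) y + f (x, y)`: it has no constant term and the invariance equation
`x ^ 2 φ'(x) = -(1 + a x) φ(x) + f (x, φ(x))` holds in `ℂ⟦x⟧`.
As `φ` has no constant term, the formal substitution of `(x, φ(x))` is well defined. -/
def IsFormalCenterManifold (a : ℝ) (f : ℝ × ℝ → ℝ) (φ : ℂ⟦X⟧) : Prop :=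
  PowerSeries.constantCoeff φ = 0 ∧
    (X : ℂ⟦X⟧) ^ 2 * PowerSeries.derivative ℂ φ =
      -(1 + PowerSeries.C (a : ℂ) * X) * φ +
        MvPowerSeries.subst (![X, φ] : Fin 2 → ℂ⟦X⟧) (taylorSeries₂ f)

/-- The formal invariant of the saddle-node `ẋ = x ^ 2`, `ẏ = -(1 + a x) y + f (x, y)`, where
`f`, `∂_y f`, `∂_x ∂_y f` vanish at the origin: the transverse linearization along the formal
center manifold `φ = f_x(0,0) x + ⋯` is `-(1 + a x) + f_y(x, φ(x)) = -(1 + α x) + O(x ^ 2)` with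
`α = a - f_x(0,0) f_yy(0,0)`. -/
noncomputable def formalInvariant (a : ℝ) (f : ℝ × ℝ → ℝ) : ℝ :=
  a - deriv (fun x => f (x, 0)) 0 * iteratedDeriv 2 (fun y => f (0, y)) 0

/-!
Write `φ = x v` and let `c j k` be the Taylor coefficients of `f`. Divided by `x`, the invariance
equation becomes a recursion `v_{n+1} = -(n + 1 + a) v_n + H_n`, where `H_n` depends only on
`v_0, …, v_n` (`invariance_iff_isBlowupSolution`). This gives existence and uniqueness, and shows
that `φ` has real coefficients.

The growth of `v_n` is measured in the `ℓ¹` norms `∑ |u_n| / D_s(n)`, where `D_s(n)` is essentially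
`(1 + s) ⋯ (n + s)`, hence comparable to `Γ (n + s + 1)`. Since `D_s(i) D_s(j) ≤ D_s(i + j)`, these
norms are submultiplicative, and since `D_s` grows faster than any geometric sequence, they are
finite on convergent double series evaluated at `(x, x v)` (`FiniteNorm.blowup`). Moreover
`1 / D_s(n) - n / D_s(n+1) = 1 / D_{s+1}(n)` for `s ≥ 0`, so that the unbounded factor `n` in the
recursion cancels exactly and what is left is `O(1 / s)`. For large `s` the recursion therefore
preserves a ball, and `v` has finite norm for some `s` (`IsBlowupSolution.exists_finiteNorm`).

To reach the sharp exponent, write `v = c₁₀ + x u`. The only part of `H` that is of the size of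
`v_n` is the term `2 c₀₂ c₁₀ v_n` coming from `c₀₂ v ^ 2`, and moving it to the left changes `a`
into `α = a - 2 c₁₀ c₀₂`, the formal invariant. The remainder is smaller than `v` by one factor `n`
(`IsBlowupSolution.finiteNorm_remainder`). So `v_{n+1} = -(n + 1 + α) v_n + Q_n` lets the exponent
`s` be lowered by one as long as it stays above `α + 2` (`finiteNorm_of_recursion`). At `s = α + 2`
one has `∑ |Q_n| / Γ (n + 2 + α) < ∞`. As `(-1)^n v_n / Γ (n + 1 + α)` has increments
`± Q_n / Γ (n + 2 + α)`, it converges (`exists_tendsto_div_Gamma`).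
-/

/-! ### The blow-up `y = x v` and the recursion for the center manifold -/

section Algebra

variable {R : Type*} [CommRing R]

/-- The homogeneous part of degree `m` of `∑ c j k x ^ j y ^ k`, evaluated at `(1, v)`. -/
noncomputable def homogPart (c : ℕ → ℕ → R) (m : ℕ) (v : R⟦X⟧) : R⟦X⟧ :=
  ∑ k ∈ Finset.range (m + 1), PowerSeries.C (c (m - k) k) * v ^ k

/-- The part of degree at least `p` of `∑ c j k x ^ j y ^ k`, evaluated at `(x, x v)` and divided
by `x ^ p`, that is, `∑ d, x ^ d * homogPart c (d + p) v`. -/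
noncomputable def blowup (c : ℕ → ℕ → R) (p : ℕ) (v : R⟦X⟧) : R⟦X⟧ :=
  PowerSeries.mk fun n => ∑ d ∈ Finset.range (n + 1), coeff (n - d) (homogPart c (d + p) v)

theorem coeff_blowup (c : ℕ → ℕ → R) (p n : ℕ) (v : R⟦X⟧) :
    coeff n (blowup c p v) =
      ∑ d ∈ Finset.range (n + 1), coeff (n - d) (homogPart c (d + p) v) := by
  simp [blowup]

theorem coeff_homogPart (c : ℕ → ℕ → R) (m n : ℕ) (v : R⟦X⟧) :
    coeff n (homogPart c m v) =
      ∑ k ∈ Finset.range (m + 1), c (m - k) k * coeff n (v ^ k) := by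
  simp [homogPart, coeff_C_mul]

theorem blowup_eq_add (c : ℕ → ℕ → R) (p : ℕ) (v : R⟦X⟧) :
    blowup c p v = homogPart c p v + X * blowup c (p + 1) v := by
  ext n
  cases n with
  | zero => simp [coeff_blowup]
  | succ n =>
    rw [map_add, coeff_succ_X_mul, coeff_blowup, coeff_blowup, Finset.sum_range_succ', add_comm]
    simp only [Nat.sub_zero, Nat.zero_add]
    congr 1
    refine Finset.sum_congr rfl fun d _ => ?_
    rw [Nat.add_sub_add_right, Nat.add_right_comm, Nat.add_assoc d p 1]

theorem coeff_pow_congr {v w : R⟦X⟧} {n : ℕ} (h : ∀ m ≤ n, coeff m v = coeff m w) (k : ℕ) :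
    ∀ m ≤ n, coeff m (v ^ k) = coeff m (w ^ k) := by
  intro m hm
  have h1 : X ^ (n + 1) ∣ v - w := by
    rw [X_pow_dvd_iff]
    intro i hi
    rw [map_sub, h i (by omega), sub_self]
  have h2 := X_pow_dvd_iff.1 (h1.trans (sub_dvd_pow_sub_pow v w k)) m (by omega)
  rwa [map_sub, sub_eq_zero] at h2

theorem coeff_blowup_congr (c : ℕ → ℕ → R) (p : ℕ) {v w : R⟦X⟧} {n : ℕ}
    (h : ∀ m ≤ n, coeff m v = coeff m w) :
    coeff n (blowup c p v) = coeff n (blowup c p w) := by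
  rw [coeff_blowup, coeff_blowup]
  refine Finset.sum_congr rfl fun d _ => ?_
  rw [coeff_homogPart, coeff_homogPart]
  refine Finset.sum_congr rfl fun k _ => ?_
  rw [coeff_pow_congr h k _ (Nat.sub_le n d)]

/-- The recursion satisfied by `v` when `x v` is a formal center manifold. -/
def IsBlowupSolution (a : R) (c : ℕ → ℕ → R) (v : R⟦X⟧) : Prop :=
  coeff 0 v = c 1 0 ∧
    ∀ n : ℕ, coeff (n + 1) v = -(1 + a + n) * coeff n v + coeff n (blowup c 2 v)

theorem IsBlowupSolution.unique {a : R} {c : ℕ → ℕ → R} {v w : R⟦X⟧}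
    (hv : IsBlowupSolution a c v) (hw : IsBlowupSolution a c w) : v = w := by
  have key : ∀ n, ∀ m ≤ n, coeff m v = coeff m w := by
    intro n
    induction n with
    | zero =>
      intro m hm
      obtain rfl : m = 0 := by omega
      rw [hv.1, hw.1]
    | succ n ih =>
      intro m hm
      rcases Nat.lt_or_ge m (n + 1) with h | h
      · exact ih m (by omega)
      · obtain rfl : m = n + 1 := by omega
        rw [hv.2, hw.2, ih n le_rfl, coeff_blowup_congr c 2 ih]
  ext n
  exact key n n le_rfl

theorem exists_isBlowupSolution (a : R) (c : ℕ → ℕ → R) : ∃ v, IsBlowupSolution a c v := by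
  let T : R⟦X⟧ → R⟦X⟧ := fun v => PowerSeries.mk fun n => Nat.casesOn n (c 1 0)
    fun n => -(1 + a + n) * coeff n v + coeff n (blowup c 2 v)
  have T0 : ∀ v, coeff 0 (T v) = c 1 0 := fun v => by simp only [T, coeff_mk]; rfl
  have TS : ∀ v n, coeff (n + 1) (T v) =
      -(1 + a + n) * coeff n v + coeff n (blowup c 2 v) := fun v n => by simp only [T, coeff_mk]
  let V : ℕ → R⟦X⟧ := fun m => T^[m] 0
  have VS : ∀ m, V (m + 1) = T (V m) := fun m => Function.iterate_succ_apply' T m 0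
  have stable : ∀ m, ∀ n < m, coeff n (V (m + 1)) = coeff n (V m) := by
    intro m
    induction m with
    | zero => intro n hn; omega
    | succ m ih =>
      intro n hn
      rw [VS (m + 1), VS m]
      cases n with
      | zero => rw [T0, T0]
      | succ n =>
        rw [TS, TS, ← VS m, ih n (by omega), coeff_blowup_congr c 2 fun i hi => ih i (by omega)]
  have stable' : ∀ n k, coeff n (V (n + 1 + k)) = coeff n (V (n + 1)) := by
    intro n k
    induction k with
    | zero => rfl
    | succ k ih => rw [← add_assoc, stable _ n (by omega), ih]
  have hv : ∀ n, ∀ m ≤ n,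
      coeff m (PowerSeries.mk fun n => coeff n (V (n + 1))) = coeff m (V (n + 1)) := by
    intro n m hm
    rw [coeff_mk, ← stable' m (n - m)]
    congr 2
    omega
  refine ⟨PowerSeries.mk fun n => coeff n (V (n + 1)), ?_, fun n => ?_⟩
  · rw [coeff_mk, VS, T0]
  · rw [hv (n + 1) (n + 1) le_rfl, VS (n + 1), TS, hv n n le_rfl, coeff_blowup_congr c 2 (hv n)]

theorem coeff_map_blowup {S : Type*} [CommRing S] (g : R →+* S) (c : ℕ → ℕ → R) (p n : ℕ)
    (v : R⟦X⟧) :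
    coeff n (blowup (fun j k => g (c j k)) p (PowerSeries.map g v)) =
      g (coeff n (blowup c p v)) := by
  simp only [coeff_blowup, coeff_homogPart, map_sum, map_mul, ← map_pow, PowerSeries.coeff_map]

theorem IsBlowupSolution.map {S : Type*} [CommRing S] (g : R →+* S) {a : R} {c : ℕ → ℕ → R}
    {v : R⟦X⟧} (hv : IsBlowupSolution a c v) :
    IsBlowupSolution (g a) (fun j k => g (c j k)) (PowerSeries.map g v) := by
  refine ⟨?_, fun n => ?_⟩
  · rw [PowerSeries.coeff_map, hv.1]
  · rw [PowerSeries.coeff_map, hv.2, PowerSeries.coeff_map, coeff_map_blowup]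
    simp

/-- The formal double series with coefficients `c j k`, variable `0` being `x` and variable `1`
being `y`. -/
def doubleSeries (c : ℕ → ℕ → R) : MvPowerSeries (Fin 2) R := fun m => c (m 0) (m 1)

/-- Substituting `(x, x v)` into a formal double series is the blow-up of order `0`. -/
theorem subst_X_X_mul (c : ℕ → ℕ → R) (v : R⟦X⟧) :
    MvPowerSeries.subst (![X, X * v] : Fin 2 → R⟦X⟧) (doubleSeries c) = blowup c 0 v := by
  have hs : MvPowerSeries.HasSubst (![X, X * v] : Fin 2 → R⟦X⟧) := by
    refine MvPowerSeries.hasSubst_of_constantCoeff_zero fun s => ?_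
    fin_cases s
    · exact PowerSeries.constantCoeff_X
    · change PowerSeries.constantCoeff (X * v) = 0
      simp
  ext n
  have hterm : ∀ m : Fin 2 →₀ ℕ, coeff n (m.prod fun s e => (![X, X * v] : Fin 2 → R⟦X⟧) s ^ e) =
      if m 0 + m 1 ≤ n then coeff (n - (m 0 + m 1)) (v ^ m 1) else 0 := by
    intro m
    rw [Finsupp.prod_fintype _ _ (by simp), Fin.prod_univ_two]
    simp only [Matrix.cons_val_zero, Matrix.cons_val_one]
    rw [mul_pow, ← mul_assoc, ← pow_add, coeff_X_pow_mul']
  refine (MvPowerSeries.coeff_subst hs (doubleSeries c) (Finsupp.single () n)).trans ?_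
  have hterm' : ∀ m : Fin 2 →₀ ℕ, MvPowerSeries.coeff m (doubleSeries c) •
      MvPowerSeries.coeff (Finsupp.single () n)
        (m.prod fun s e => (![X, X * v] : Fin 2 → R⟦X⟧) s ^ e) =
      if m 0 + m 1 ≤ n then c (m 0) (m 1) * coeff (n - (m 0 + m 1)) (v ^ m 1) else 0 := by
    intro m
    refine (congrArg (fun z => c (m 0) (m 1) * z) (hterm m)).trans ?_
    simp only [mul_ite, mul_zero]
  rw [finsum_congr hterm']
  -- The pairs `(j, k)` with `j + k ≤ n` are enumerated by `d = j + k` and `k ≤ d`.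
  let e : (Σ _ : ℕ, ℕ) → (Fin 2 →₀ ℕ) := fun q =>
    Finsupp.equivFunOnFinite.symm ![q.1 - q.2, q.2]
  have e0 : ∀ q, e q 0 = q.1 - q.2 := fun q => rfl
  have e1 : ∀ q, e q 1 = q.2 := fun q => rfl
  let s : Finset (Σ _ : ℕ, ℕ) := (Finset.range (n + 1)).sigma fun d => Finset.range (d + 1)
  have he : Set.InjOn e s := by
    rintro ⟨d, k⟩ h ⟨d', k'⟩ h' hq
    simp only [s, Finset.coe_sigma, Set.mem_sigma_iff, Finset.mem_coe, Finset.mem_range] at h h'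
    have h0 := DFunLike.congr_fun hq 0
    have h1 := DFunLike.congr_fun hq 1
    simp only [e0, e1] at h0 h1
    have : d = d' := by omega
    subst this h1
    rfl
  rw [finsum_eq_sum_of_support_subset (s := s.image e), Finset.sum_image he, Finset.sum_sigma,
    coeff_blowup]
  · refine Finset.sum_congr rfl fun d hd => ?_
    rw [coeff_homogPart]
    refine Finset.sum_congr rfl fun k hk => ?_
    rw [Finset.mem_range] at hd hk
    simp only [e0, e1]
    rw [Nat.sub_add_cancel (by omega : k ≤ d), if_pos (by omega)]
    rfl
  · intro m hm
    rw [Function.mem_support] at hm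
    have hle : m 0 + m 1 ≤ n := by
      by_contra h
      exact hm (if_neg h)
    rw [Finset.coe_image]
    refine ⟨⟨m 0 + m 1, m 1⟩, ?_, ?_⟩
    · simp only [s, Finset.coe_sigma, Set.mem_sigma_iff, Finset.mem_coe, Finset.mem_range]
      omega
    · ext i
      fin_cases i
      · change m 0 + m 1 - m 1 = m 0
        omega
      · rfl

theorem homogPart_zero (c : ℕ → ℕ → R) (v : R⟦X⟧) :
    homogPart c 0 v = PowerSeries.C (c 0 0) := by
  simp [homogPart]

theorem homogPart_one (c : ℕ → ℕ → R) (v : R⟦X⟧) :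
    homogPart c 1 v = PowerSeries.C (c 1 0) + PowerSeries.C (c 0 1) * v := by
  simp [homogPart, Finset.sum_range_succ]

theorem homogPart_two (c : ℕ → ℕ → R) (v : R⟦X⟧) :
    homogPart c 2 v =
      PowerSeries.C (c 2 0) + PowerSeries.C (c 1 1) * v + PowerSeries.C (c 0 2) * v ^ 2 := by
  simp [homogPart, Finset.sum_range_succ]

/-- The invariance equation for `φ = x v`, divided by `x`, is the recursion for `v`. -/
theorem invariance_iff_isBlowupSolution [IsDomain R] (a : R) {c : ℕ → ℕ → R} (h00 : c 0 0 = 0)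
    (h01 : c 0 1 = 0) (v : R⟦X⟧) :
    X ^ 2 * PowerSeries.derivative R (X * v) =
        -(1 + PowerSeries.C a * X) * (X * v) +
          MvPowerSeries.subst (![X, X * v] : Fin 2 → R⟦X⟧) (doubleSeries c) ↔
      IsBlowupSolution a c v := by
  have hd : PowerSeries.derivative R (X * v) = v + X * PowerSeries.derivative R v := by
    rw [Derivation.leibniz, derivative_X]
    simp only [smul_eq_mul, mul_one]
    ring
  rw [subst_X_X_mul, blowup_eq_add, blowup_eq_add, homogPart_zero, homogPart_one, h00, h01, hd]
  have hX : (X : R⟦X⟧) ≠ 0 := X_ne_zero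
  have e1 : X ^ 2 * (v + X * PowerSeries.derivative R v) =
        -(1 + PowerSeries.C a * X) * (X * v) + (PowerSeries.C 0 +
          X * (PowerSeries.C (c 1 0) + PowerSeries.C 0 * v + X * blowup c (0 + 1 + 1) v)) ↔
      v = PowerSeries.C (c 1 0) + X * (blowup c 2 v - (1 + PowerSeries.C a) * v
        - X * PowerSeries.derivative R v) := by
    rw [map_zero]
    constructor
    · intro h
      apply mul_left_cancel₀ hX
      linear_combination h
    · intro h
      linear_combination X * h
  rw [e1, PowerSeries.ext_iff]
  have hz : coeff 0 (PowerSeries.C (c 1 0) + X * (blowup c 2 v - (1 + PowerSeries.C a) * v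
        - X * PowerSeries.derivative R v)) = c 1 0 := by simp
  have hS : ∀ n, coeff (n + 1) (PowerSeries.C (c 1 0) + X * (blowup c 2 v -
      (1 + PowerSeries.C a) * v - X * PowerSeries.derivative R v)) =
        -(1 + a + n) * coeff n v + coeff n (blowup c 2 v) := by
    intro n
    have hD : coeff n (X * PowerSeries.derivative R v) = n * coeff n v := by
      cases n with
      | zero => simp
      | succ n =>
        rw [coeff_succ_X_mul, coeff_derivative]
        push_cast
        ring
    rw [map_add, coeff_succ_X_mul, coeff_C, if_neg (Nat.succ_ne_zero n), map_sub, map_sub, hD,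
      add_mul, one_mul, map_add, coeff_C_mul]
    ring
  constructor
  · intro h
    exact ⟨(h 0).trans hz, fun n => (h (n + 1)).trans (hS n)⟩
  · rintro ⟨h0, h1⟩ n
    cases n with
    | zero => exact h0.trans hz.symm
    | succ n => exact (h1 n).trans (hS n).symm

end Algebra

/-! ### Factorially weighted norms on formal power series -/

section Weights

/-- The weight `(1 + s) (2 + s) ⋯ (n + s)`, with factors smaller than `1` replaced by `1`. For large
`n` it is a constant multiple of `Γ (n + s + 1)`, and the replacement makes it positive and
supermultiplicative for every real `s`. -/
noncomputable def gammaWeight (s : ℝ) (n : ℕ) : ℝ :=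
  ∏ i ∈ Finset.range n, max 1 ((i : ℝ) + 1 + s)

theorem gammaWeight_zero (s : ℝ) : gammaWeight s 0 = 1 := by simp [gammaWeight]

theorem gammaWeight_succ (s : ℝ) (n : ℕ) :
    gammaWeight s (n + 1) = gammaWeight s n * max 1 ((n : ℝ) + 1 + s) := by
  rw [gammaWeight, Finset.prod_range_succ, ← gammaWeight]

theorem gammaWeight_succ' (s : ℝ) (n : ℕ) :
    gammaWeight s (n + 1) = max 1 (1 + s) * gammaWeight (s + 1) n := by
  rw [gammaWeight, Finset.prod_range_succ', mul_comm, gammaWeight]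
  congr 1
  · simp
  · refine Finset.prod_congr rfl fun i _ => ?_
    congr 1
    push_cast
    ring

theorem gammaWeight_pos (s : ℝ) (n : ℕ) : 0 < gammaWeight s n :=
  Finset.prod_pos fun _ _ => lt_max_of_lt_left one_pos

theorem gammaWeight_mono {s t : ℝ} (h : s ≤ t) (n : ℕ) : gammaWeight s n ≤ gammaWeight t n :=
  Finset.prod_le_prod (fun _ _ => le_max_of_le_left zero_le_one) fun _ _ =>
    max_le_max le_rfl (by linarith)

theorem gammaWeight_mul_le (s : ℝ) (i j : ℕ) :
    gammaWeight s i * gammaWeight s j ≤ gammaWeight s (i + j) := by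
  rw [gammaWeight, gammaWeight, gammaWeight, Finset.prod_range_add]
  refine mul_le_mul_of_nonneg_left ?_
    (Finset.prod_nonneg fun _ _ => le_max_of_le_left zero_le_one)
  refine Finset.prod_le_prod (fun _ _ => le_max_of_le_left zero_le_one) fun k _ =>
    max_le_max le_rfl ?_
  push_cast
  have : (0 : ℝ) ≤ i := Nat.cast_nonneg i
  linarith

/-- The weights grow faster than any geometric sequence. -/
theorem summable_geometric_div_gammaWeight (s : ℝ) (p : ℕ) {Y : ℝ} (hY : 0 ≤ Y) :
    Summable fun d : ℕ => ((d : ℝ) + p + 1) * Y ^ (d + p) / gammaWeight s d := by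
  refine summable_of_ratio_norm_eventually_le (r := 1 / 2) (by norm_num) ?_
  filter_upwards [eventually_ge_atTop ⌈4 * Y - s⌉₊] with d hd
  have hd' : 4 * Y - s ≤ d := Nat.ceil_le.1 hd
  have hD := gammaWeight_pos s d
  have hd0 : (0 : ℝ) ≤ d := Nat.cast_nonneg d
  have hp0 : (0 : ℝ) ≤ p := Nat.cast_nonneg p
  have hm : 4 * Y ≤ max 1 ((d : ℝ) + 1 + s) := le_max_of_le_right (by linarith)
  have hm1 : (0 : ℝ) < max 1 ((d : ℝ) + 1 + s) := lt_max_of_lt_left one_pos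
  rw [Real.norm_of_nonneg (by have := gammaWeight_pos s (d + 1); positivity),
    Real.norm_of_nonneg (by positivity), gammaWeight_succ, div_le_iff₀ (by positivity)]
  have e : 1 / 2 * (((d : ℝ) + p + 1) * Y ^ (d + p) / gammaWeight s d) *
      (gammaWeight s d * max 1 ((d : ℝ) + 1 + s)) =
      1 / 2 * ((d : ℝ) + p + 1) * Y ^ (d + p) * max 1 ((d : ℝ) + 1 + s) := by
    field_simp
  rw [e]
  calc ((↑(d + 1) : ℝ) + p + 1) * Y ^ (d + 1 + p)
      = ((d : ℝ) + p + 2) * Y ^ (d + p) * Y := by push_cast; ring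
    _ ≤ (2 * ((d : ℝ) + p + 1)) * Y ^ (d + p) * Y := by gcongr; linarith
    _ = 1 / 2 * ((d : ℝ) + p + 1) * Y ^ (d + p) * (4 * Y) := by ring
    _ ≤ _ := by gcongr

/-- The partial sum up to degree `n` of the weighted `ℓ¹` norm `∑ |u_m| / gammaWeight s m`. -/
noncomputable def partialNorm (s : ℝ) (n : ℕ) (u : ℝ⟦X⟧) : ℝ :=
  ∑ m ∈ Finset.range (n + 1), |coeff m u| / gammaWeight s m

theorem partialNorm_nonneg (s : ℝ) (n : ℕ) (u : ℝ⟦X⟧) : 0 ≤ partialNorm s n u :=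
  Finset.sum_nonneg fun m _ => div_nonneg (abs_nonneg _) (gammaWeight_pos s m).le

theorem partialNorm_congr (s : ℝ) {n : ℕ} {u v : ℝ⟦X⟧} (h : ∀ m ≤ n, coeff m u = coeff m v) :
    partialNorm s n u = partialNorm s n v :=
  Finset.sum_congr rfl fun m hm => by
    rw [h m (Nat.lt_succ_iff.1 (Finset.mem_range.1 hm))]

theorem partialNorm_add_le (s : ℝ) (n : ℕ) (u v : ℝ⟦X⟧) :
    partialNorm s n (u + v) ≤ partialNorm s n u + partialNorm s n v := by
  rw [partialNorm, partialNorm, partialNorm, ← Finset.sum_add_distrib]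
  refine Finset.sum_le_sum fun m _ => ?_
  rw [← add_div, map_add]
  exact div_le_div_of_nonneg_right (abs_add_le _ _) (gammaWeight_pos s m).le

theorem partialNorm_zero (s : ℝ) (n : ℕ) : partialNorm s n 0 = 0 := by simp [partialNorm]

theorem partialNorm_sum_le {ι : Type*} (s : ℝ) (n : ℕ) (t : Finset ι) (u : ι → ℝ⟦X⟧) :
    partialNorm s n (∑ i ∈ t, u i) ≤ ∑ i ∈ t, partialNorm s n (u i) :=
  Finset.le_sum_of_subadditive _ (partialNorm_zero s n).le (partialNorm_add_le s n) t u

theorem partialNorm_C (s : ℝ) (n : ℕ) (r : ℝ) : partialNorm s n (PowerSeries.C r) = |r| := by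
  rw [partialNorm, Finset.sum_eq_single_of_mem 0 (by simp)]
  · simp [gammaWeight_zero]
  · intro m _ hm
    simp [coeff_C, hm]

theorem partialNorm_X_pow_le (s : ℝ) (n d : ℕ) :
    partialNorm s n (X ^ d) ≤ 1 / gammaWeight s d := by
  have h : ∀ m, |coeff m (X ^ d : ℝ⟦X⟧)| / gammaWeight s m =
      if m = d then 1 / gammaWeight s d else 0 := by
    intro m
    rw [coeff_X_pow]
    split_ifs with h
    · simp [h]
    · simp
  rw [partialNorm, Finset.sum_congr rfl fun m _ => h m, Finset.sum_ite_eq']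
  split_ifs
  · exact le_rfl
  · exact (one_div_pos.2 (gammaWeight_pos s d)).le

theorem partialNorm_mul_le (s : ℝ) (n : ℕ) (u v : ℝ⟦X⟧) :
    partialNorm s n (u * v) ≤ partialNorm s n u * partialNorm s n v := by
  have h0 : ∀ (w : ℝ⟦X⟧) m, 0 ≤ |coeff m w| / gammaWeight s m := fun w m =>
    div_nonneg (abs_nonneg _) (gammaWeight_pos s m).le
  have h1 : ∀ m, |coeff m (u * v)| / gammaWeight s m ≤ ∑ q ∈ Finset.HasAntidiagonal.antidiagonal m,
      |coeff q.1 u| / gammaWeight s q.1 * (|coeff q.2 v| / gammaWeight s q.2) := by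
    intro m
    rw [coeff_mul]
    refine (div_le_div_of_nonneg_right (Finset.abs_sum_le_sum_abs _ _)
      (gammaWeight_pos s m).le).trans ?_
    rw [Finset.sum_div]
    refine Finset.sum_le_sum fun q hq => ?_
    rw [abs_mul, div_mul_div_comm]
    rw [Finset.HasAntidiagonal.mem_antidiagonal] at hq
    have := gammaWeight_mul_le s q.1 q.2
    rw [hq] at this
    exact div_le_div_of_nonneg_left (by positivity)
      (mul_pos (gammaWeight_pos s _) (gammaWeight_pos s _)) this
  refine (Finset.sum_le_sum fun m _ => h1 m).trans ?_
  have hinj : Set.InjOn (fun x : (Σ _ : ℕ, ℕ × ℕ) => x.2)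
      ((Finset.range (n + 1)).sigma fun m => Finset.HasAntidiagonal.antidiagonal m) := by
    rintro ⟨m, q⟩ h ⟨m', q'⟩ h' hq
    simp only [Finset.coe_sigma, Set.mem_sigma_iff, Finset.mem_coe,
      Finset.HasAntidiagonal.mem_antidiagonal] at h h' hq
    subst hq
    obtain rfl : m = m' := h.2.symm.trans h'.2
    rfl
  rw [partialNorm, partialNorm, Finset.sum_mul_sum, ← Finset.sum_product', Finset.sum_sigma',
    ← Finset.sum_image (f := fun q : ℕ × ℕ =>
      |coeff q.1 u| / gammaWeight s q.1 * (|coeff q.2 v| / gammaWeight s q.2)) hinj]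
  refine Finset.sum_le_sum_of_subset_of_nonneg ?_ fun q _ _ => mul_nonneg (h0 u _) (h0 v _)
  intro q hq
  simp only [Finset.mem_image, Finset.mem_sigma, Finset.HasAntidiagonal.mem_antidiagonal,
    Finset.mem_range, Finset.mem_product] at hq ⊢
  obtain ⟨⟨m, q'⟩, h, rfl⟩ := hq
  dsimp only at h ⊢
  omega

theorem partialNorm_pow_le (s : ℝ) (n : ℕ) (u : ℝ⟦X⟧) (k : ℕ) :
    partialNorm s n (u ^ k) ≤ partialNorm s n u ^ k := by
  induction k with
  | zero =>
    rw [pow_zero, pow_zero, ← map_one (PowerSeries.C (R := ℝ)), partialNorm_C, abs_one]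
  | succ k ih =>
    rw [pow_succ, pow_succ]
    exact (partialNorm_mul_le s n _ _).trans
      (mul_le_mul_of_nonneg_right ih (partialNorm_nonneg s n u))

theorem partialNorm_homogPart_le {c : ℕ → ℕ → ℝ} {K B : ℝ} (hB : 0 ≤ B)
    (hc : ∀ j k, |c j k| ≤ K * B ^ (j + k)) (s : ℝ) (n m : ℕ) {v : ℝ⟦X⟧} {M : ℝ}
    (hM : partialNorm s n v ≤ M) :
    partialNorm s n (homogPart c m v) ≤ K * (((m : ℝ) + 1) * (B * (1 + M)) ^ m) := by
  have hM0 : 0 ≤ M := (partialNorm_nonneg s n v).trans hM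
  have hK : 0 ≤ K := by simpa using (abs_nonneg _).trans (hc 0 0)
  have h : ∀ k ∈ Finset.range (m + 1), partialNorm s n (PowerSeries.C (c (m - k) k) * v ^ k) ≤
      K * (B * (1 + M)) ^ m := by
    intro k hk
    have hk : k ≤ m := Nat.lt_succ_iff.1 (Finset.mem_range.1 hk)
    refine (partialNorm_mul_le s n _ _).trans ?_
    rw [partialNorm_C, mul_pow, ← mul_assoc]
    have h1 := hc (m - k) k
    rw [Nat.sub_add_cancel hk] at h1
    refine mul_le_mul h1 ?_ (partialNorm_nonneg s n _) (by positivity)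
    calc partialNorm s n (v ^ k) ≤ partialNorm s n v ^ k := partialNorm_pow_le s n v k
      _ ≤ (1 + M) ^ k := pow_le_pow_left₀ (partialNorm_nonneg s n v) (by linarith) k
      _ ≤ (1 + M) ^ m := pow_le_pow_right₀ (by linarith) hk
  refine (partialNorm_sum_le s n _ _).trans ((Finset.sum_le_sum h).trans (le_of_eq ?_))
  rw [Finset.sum_const, Finset.card_range, nsmul_eq_mul]
  push_cast
  ring

theorem partialNorm_blowup_le {c : ℕ → ℕ → ℝ} {K B : ℝ} (hB : 0 ≤ B)
    (hc : ∀ j k, |c j k| ≤ K * B ^ (j + k)) (s : ℝ) (n p : ℕ) {v : ℝ⟦X⟧} {M : ℝ}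
    (hM : partialNorm s n v ≤ M) :
    partialNorm s n (blowup c p v) ≤
      K * ∑' d : ℕ, ((d : ℝ) + p + 1) * (B * (1 + M)) ^ (d + p) / gammaWeight s d := by
  have hM0 : 0 ≤ M := (partialNorm_nonneg s n v).trans hM
  have hK : 0 ≤ K := by simpa using (abs_nonneg _).trans (hc 0 0)
  have hY : 0 ≤ B * (1 + M) := by positivity
  have e : partialNorm s n (blowup c p v) =
      partialNorm s n (∑ d ∈ Finset.range (n + 1), X ^ d * homogPart c (d + p) v) := by
    refine partialNorm_congr s fun m hm => ?_
    rw [coeff_blowup, map_sum]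
    simp only [coeff_X_pow_mul']
    rw [← Finset.sum_filter]
    refine Finset.sum_congr ?_ fun _ _ => rfl
    ext d
    simp only [Finset.mem_range, Finset.mem_filter]
    omega
  rw [e]
  refine (partialNorm_sum_le s n _ _).trans ?_
  have h : ∀ d ∈ Finset.range (n + 1), partialNorm s n (X ^ d * homogPart c (d + p) v) ≤
      K * (((d : ℝ) + p + 1) * (B * (1 + M)) ^ (d + p) / gammaWeight s d) := by
    intro d _
    refine (partialNorm_mul_le s n _ _).trans ?_
    have h1 := partialNorm_homogPart_le hB hc s n (d + p) hM
    have h2 := partialNorm_X_pow_le s n d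
    refine (mul_le_mul h2 h1 (partialNorm_nonneg s n _)
      (one_div_pos.2 (gammaWeight_pos s d)).le).trans (le_of_eq ?_)
    push_cast
    ring
  refine (Finset.sum_le_sum h).trans ?_
  rw [← Finset.mul_sum]
  refine mul_le_mul_of_nonneg_left ?_ hK
  exact (summable_geometric_div_gammaWeight s p hY).sum_le_tsum _ fun d _ =>
    div_nonneg (by positivity) (gammaWeight_pos s d).le

/-- `u` has finite weighted norm, that is, `∑ |u_n| / Γ (n + s + 1)` converges (up to the finitely
many `n` at which `n + s + 1` is small). -/
def FiniteNorm (s : ℝ) (u : ℝ⟦X⟧) : Prop := ∃ M, ∀ n, partialNorm s n u ≤ M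

theorem FiniteNorm.summable {s : ℝ} {u : ℝ⟦X⟧} (h : FiniteNorm s u) :
    Summable fun n => |coeff n u| / gammaWeight s n := by
  obtain ⟨M, hM⟩ := h
  refine summable_of_sum_range_le (c := M)
    (fun n => div_nonneg (abs_nonneg _) (gammaWeight_pos s n).le) fun n => ?_
  refine le_trans ?_ (hM n)
  exact Finset.sum_le_sum_of_subset_of_nonneg (Finset.range_subset_range.2 (by omega))
    fun m _ _ => div_nonneg (abs_nonneg _) (gammaWeight_pos s m).le

theorem finiteNorm_of_summable {s : ℝ} {u : ℝ⟦X⟧}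
    (h : Summable fun n => |coeff n u| / gammaWeight s n) : FiniteNorm s u :=
  ⟨_, fun _ => h.sum_le_tsum _ fun m _ => div_nonneg (abs_nonneg _) (gammaWeight_pos s m).le⟩

theorem finiteNorm_C (s r : ℝ) : FiniteNorm s (PowerSeries.C r) :=
  ⟨|r|, fun n => (partialNorm_C s n r).le⟩

theorem FiniteNorm.add {s : ℝ} {u v : ℝ⟦X⟧} (hu : FiniteNorm s u) (hv : FiniteNorm s v) :
    FiniteNorm s (u + v) := by
  obtain ⟨M, hM⟩ := hu
  obtain ⟨N, hN⟩ := hv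
  exact ⟨M + N, fun n => (partialNorm_add_le s n u v).trans (add_le_add (hM n) (hN n))⟩

theorem FiniteNorm.mul {s : ℝ} {u v : ℝ⟦X⟧} (hu : FiniteNorm s u) (hv : FiniteNorm s v) :
    FiniteNorm s (u * v) := by
  obtain ⟨M, hM⟩ := hu
  obtain ⟨N, hN⟩ := hv
  exact ⟨M * N, fun n => (partialNorm_mul_le s n u v).trans
    (mul_le_mul (hM n) (hN n) (partialNorm_nonneg s n v) ((partialNorm_nonneg s n u).trans (hM n)))⟩

theorem FiniteNorm.blowup {c : ℕ → ℕ → ℝ} {K B : ℝ} (hB : 0 ≤ B)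
    (hc : ∀ j k, |c j k| ≤ K * B ^ (j + k)) {s : ℝ} {v : ℝ⟦X⟧} (hv : FiniteNorm s v) (p : ℕ) :
    FiniteNorm s (blowup c p v) := by
  obtain ⟨M, hM⟩ := hv
  exact ⟨_, fun n => partialNorm_blowup_le hB hc s n p (hM n)⟩

theorem FiniteNorm.X_mul {s : ℝ} {u : ℝ⟦X⟧} (hu : FiniteNorm (s + 1) u) :
    FiniteNorm s (X * u) := by
  refine finiteNorm_of_summable ((summable_nat_add_iff 1).1 ?_)
  refine (hu.summable.div_const (max 1 (1 + s))).congr fun n => ?_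
  rw [coeff_succ_X_mul, gammaWeight_succ', div_div, mul_comm]

theorem FiniteNorm.of_C_add_X_mul {s r : ℝ} {u : ℝ⟦X⟧}
    (hu : FiniteNorm s (PowerSeries.C r + X * u)) : FiniteNorm (s + 1) u := by
  refine finiteNorm_of_summable ?_
  have h := ((summable_nat_add_iff 1).2 hu.summable).mul_left (max 1 (1 + s))
  refine h.congr fun n => ?_
  have hm : (0 : ℝ) < max 1 (1 + s) := lt_max_of_lt_left one_pos
  rw [map_add, coeff_C, if_neg (Nat.succ_ne_zero n), zero_add, coeff_succ_X_mul,
    gammaWeight_succ']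
  field_simp

end Weights

/-! ### A priori growth bound for the coefficients -/

section Growth

theorem FiniteNorm.mono {s t : ℝ} (hst : s ≤ t) {u : ℝ⟦X⟧} (hu : FiniteNorm s u) :
    FiniteNorm t u := by
  obtain ⟨M, hM⟩ := hu
  refine ⟨M, fun n => (Finset.sum_le_sum fun m _ => ?_).trans (hM n)⟩
  exact div_le_div_of_nonneg_left (abs_nonneg _) (gammaWeight_pos s m) (gammaWeight_mono hst m)

/-- The factor `n` in the recursion is absorbed exactly by passing from the weight with parameter
`s` to the one with parameter `s + 1`. What remains of the recursion carries a factor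
`1 / (1 + s)`. -/
theorem partialNorm_succ_le_of_isBlowupSolution {a s : ℝ} (hs : 0 ≤ s) {c : ℕ → ℕ → ℝ}
    {v : ℝ⟦X⟧} (hv : IsBlowupSolution a c v) (n : ℕ) :
    partialNorm (s + 1) (n + 1) v ≤ |c 1 0| +
      ((1 + |a|) * partialNorm (s + 1) n v + partialNorm (s + 1) n (blowup c 2 v)) / (1 + s) := by
  have hs1 : 0 < 1 + s := by linarith
  have hD1 : ∀ m, gammaWeight s (m + 1) = (1 + s) * gammaWeight (s + 1) m := fun m => by
    rw [gammaWeight_succ', max_eq_right (by linarith)]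
  have hD2 : ∀ m : ℕ, gammaWeight s (m + 1) = gammaWeight s m * (m + 1 + s) := fun m => by
    rw [gammaWeight_succ, max_eq_right]
    have : (0 : ℝ) ≤ m := Nat.cast_nonneg m
    linarith
  have hsplit : ∀ m : ℕ, |coeff m v| / gammaWeight s m =
      |coeff m v| / gammaWeight (s + 1) m + m * |coeff m v| / gammaWeight s (m + 1) := by
    intro m
    have h1 := gammaWeight_pos s m
    have h2 := gammaWeight_pos (s + 1) m
    have hm : (0 : ℝ) < m + 1 + s := by
      have : (0 : ℝ) ≤ m := Nat.cast_nonneg m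
      linarith
    have h3 : gammaWeight (s + 1) m = gammaWeight s m * (m + 1 + s) / (1 + s) := by
      rw [← hD2, hD1, mul_div_cancel_left₀ _ hs1.ne']
    rw [hD2, h3]
    field_simp
    ring
  have hrec : ∀ m : ℕ, |coeff (m + 1) v| / gammaWeight s (m + 1) ≤
      m * |coeff m v| / gammaWeight s (m + 1) +
        ((1 + |a|) * (|coeff m v| / gammaWeight (s + 1) m) +
          |coeff m (blowup c 2 v)| / gammaWeight (s + 1) m) / (1 + s) := by
    intro m
    have h2 := gammaWeight_pos (s + 1) m
    have h3 : |coeff (m + 1) v| ≤ m * |coeff m v| +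
        ((1 + |a|) * |coeff m v| + |coeff m (blowup c 2 v)|) := by
      rw [hv.2 m]
      refine (abs_add_le _ _).trans ?_
      have h4 : |-(1 + a + m)| ≤ 1 + |a| + m := by
        rw [abs_neg]
        refine (abs_add_le _ _).trans (add_le_add ((abs_add_le _ _).trans ?_) ?_)
        · rw [abs_one]
        · rw [Nat.abs_cast]
      rw [abs_mul]
      have := mul_le_mul_of_nonneg_right h4 (abs_nonneg (coeff m v))
      linarith
    have h5 := div_le_div_of_nonneg_right h3 (gammaWeight_pos s (m + 1)).le
    refine h5.trans (le_of_eq ?_)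
    rw [add_div, hD1]
    field_simp
  have hA := Finset.sum_range_succ' (fun m => |coeff m v| / gammaWeight s m) (n + 1)
  rw [Finset.sum_range_succ, gammaWeight_zero, div_one, hv.1] at hA
  have hB := Finset.sum_le_sum fun m (_ : m ∈ Finset.range (n + 1)) => hrec m
  rw [Finset.sum_add_distrib, ← Finset.sum_div, Finset.sum_add_distrib, ← Finset.mul_sum] at hB
  have hC := Finset.sum_congr (rfl : Finset.range (n + 1) = _) fun m _ => hsplit m
  rw [Finset.sum_add_distrib] at hC
  have hE : |coeff (n + 1) v| / gammaWeight (s + 1) (n + 1) ≤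
      |coeff (n + 1) v| / gammaWeight s (n + 1) :=
    div_le_div_of_nonneg_left (abs_nonneg _) (gammaWeight_pos s _)
      (gammaWeight_mono (by linarith) _)
  have hF : partialNorm (s + 1) (n + 1) v = partialNorm (s + 1) n v +
      |coeff (n + 1) v| / gammaWeight (s + 1) (n + 1) := Finset.sum_range_succ _ _
  rw [hF]
  unfold partialNorm
  linarith

/-- The coefficients of a blow-up solution grow at most like `Γ (n + s + 1)` for some `s`. -/
theorem IsBlowupSolution.exists_finiteNorm {a : ℝ} {c : ℕ → ℕ → ℝ} {K B : ℝ} (hB : 0 ≤ B)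
    (hc : ∀ j k, |c j k| ≤ K * B ^ (j + k)) {v : ℝ⟦X⟧} (hv : IsBlowupSolution a c v) :
    ∃ s, FiniteNorm s v := by
  set M : ℝ := |c 1 0| + 1 with hM
  have hM0 : 0 ≤ M := by positivity
  have hK : 0 ≤ K := by simpa using (abs_nonneg _).trans (hc 0 0)
  have hY : 0 ≤ B * (1 + M) := by positivity
  set E : ℝ := K * ∑' d : ℕ, ((d : ℝ) + (2 : ℕ) + 1) * (B * (1 + M)) ^ (d + 2) / gammaWeight 0 d
    with hE
  have hE0 : 0 ≤ E := mul_nonneg hK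
    (tsum_nonneg fun d => div_nonneg (by positivity) (gammaWeight_pos 0 d).le)
  -- With this parameter the nonlinear recursion maps the ball of radius `M` into itself.
  set s : ℝ := (1 + |a|) * M + E with hs
  have hs0 : 0 ≤ s := by positivity
  refine ⟨s + 1, M, fun n => ?_⟩
  induction n with
  | zero =>
    simp only [partialNorm, Nat.zero_add, Finset.sum_range_one, gammaWeight_zero, div_one, hv.1]
    linarith
  | succ n ih =>
    have h1 : partialNorm (s + 1) n (blowup c 2 v) ≤ E := by
      refine (partialNorm_blowup_le hB hc (s + 1) n 2 ih).trans ?_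
      refine mul_le_mul_of_nonneg_left ?_ hK
      refine Summable.tsum_le_tsum (fun d => ?_) (summable_geometric_div_gammaWeight _ 2 hY)
        (summable_geometric_div_gammaWeight _ 2 hY)
      exact div_le_div_of_nonneg_left (by positivity) (gammaWeight_pos 0 d)
        (gammaWeight_mono (by linarith) d)
    refine (partialNorm_succ_le_of_isBlowupSolution hs0 hv n).trans ?_
    have h2 : ((1 + |a|) * partialNorm (s + 1) n v + partialNorm (s + 1) n (blowup c 2 v)) /
        (1 + s) ≤ 1 := by
      rw [div_le_one (by linarith)]
      have := mul_le_mul_of_nonneg_left ih (by positivity : 0 ≤ 1 + |a|)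
      linarith
    linarith

end Growth

/-! ### Convergence of the normalized coefficients -/

section Asymptotics

/-- What remains of the recursion for `v` once its part `-(n + 1 + α) v_n` is split off, where
`α = a - 2 c₁₀ c₀₂`. -/
noncomputable def remainder (c : ℕ → ℕ → ℝ) (v : ℝ⟦X⟧) : ℝ⟦X⟧ :=
  blowup c 2 v - PowerSeries.C (2 * c 0 2 * c 1 0) * v

theorem IsBlowupSolution.coeff_succ {a : ℝ} {c : ℕ → ℕ → ℝ} {v : ℝ⟦X⟧}
    (hv : IsBlowupSolution a c v) (n : ℕ) :
    coeff (n + 1) v =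
      -((n : ℝ) + 1 + (a - c 1 0 * (2 * c 0 2))) * coeff n v + coeff n (remainder c v) := by
  rw [hv.2, remainder, map_sub, coeff_C_mul]
  ring

/-- The remainder gains one power of `n` over `v`. Writing `v = c₁₀ + x u`, the quadratic part
`c₀₂ (v ^ 2 - 2 c₁₀ v)` of the remainder is a constant plus `c₀₂ x ^ 2 u ^ 2`: the term that is
linear in `x u` has gone into `α`. -/
theorem IsBlowupSolution.finiteNorm_remainder {a : ℝ} {c : ℕ → ℕ → ℝ} {K B : ℝ} (hB : 0 ≤ B)
    (hc : ∀ j k, |c j k| ≤ K * B ^ (j + k)) (h11 : c 1 1 = 0) {v : ℝ⟦X⟧}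
    (hv : IsBlowupSolution a c v) {s : ℝ} (hs : FiniteNorm (s + 1) v) :
    FiniteNorm s (remainder c v) := by
  obtain ⟨u, hu⟩ : ∃ u, v = PowerSeries.C (c 1 0) + X * u := by
    refine ⟨PowerSeries.mk fun n => coeff (n + 1) v, ?_⟩
    rw [← hv.1, coeff_zero_eq_constantCoeff_apply, add_comm]
    exact eq_X_mul_shift_add_const v
  have hu' : FiniteNorm (s + 1 + 1) u := FiniteNorm.of_C_add_X_mul (hu ▸ hs)
  have e : remainder c v = PowerSeries.C (c 2 0 - c 0 2 * c 1 0 ^ 2) +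
      PowerSeries.C (c 0 2) * (X * (X * (u * u))) + X * blowup c 3 v := by
    rw [remainder, blowup_eq_add, homogPart_two, h11]
    have : PowerSeries.C (c 0 2) * v ^ 2 - PowerSeries.C (2 * c 0 2 * c 1 0) * v =
        PowerSeries.C (c 0 2) * (X * (X * (u * u))) - PowerSeries.C (c 0 2 * c 1 0 ^ 2) := by
      rw [hu]
      simp only [map_mul, map_pow, map_ofNat]
      ring
    rw [map_zero, map_sub]
    linear_combination this
  rw [e]
  exact ((finiteNorm_C s _).add ((finiteNorm_C s _).mul (hu'.mul hu').X_mul.X_mul)).add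
    (hs.blowup hB hc 3).X_mul

theorem summable_of_succ_add_le {b e q : ℕ → ℝ} (hb : ∀ n, 0 ≤ b n) (he : ∀ n, 0 ≤ e n)
    (hq0 : ∀ n, 0 ≤ q n) (hq : Summable q) {N : ℕ} (h : ∀ n ≥ N, b (n + 1) + e n ≤ b n + q n) :
    Summable e := by
  refine (summable_nat_add_iff N).1 ?_
  have hq' : Summable fun n => q (n + N) := (summable_nat_add_iff N).2 hq
  refine summable_of_sum_range_le (c := b N + ∑' n, q (n + N)) (fun n => he _) fun n => ?_
  have key : ∀ n, b (n + N) + ∑ i ∈ Finset.range n, e (i + N) ≤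
      b N + ∑ i ∈ Finset.range n, q (i + N) := by
    intro n
    induction n with
    | zero => simp
    | succ n ih =>
      rw [Finset.sum_range_succ, Finset.sum_range_succ]
      have := h (n + N) (by omega)
      rw [Nat.add_right_comm n 1 N]
      linarith
  have h1 := key n
  have h2 := hq'.sum_le_tsum (Finset.range n) fun i _ => hq0 _
  have h3 := hb (n + N)
  linarith

/-- As long as `α < s`, a solution of the linear recursion inherits the norm of its
inhomogeneity. -/
theorem finiteNorm_of_recursion {α s : ℝ} (hs : α < s) {v Q : ℝ⟦X⟧}
    (hrec : ∀ n : ℕ, coeff (n + 1) v = -((n : ℝ) + 1 + α) * coeff n v + coeff n Q)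
    (hQ : FiniteNorm (s + 1) Q) : FiniteNorm (s + 1) v := by
  have hm : (0 : ℝ) < max 1 (1 + s) := lt_max_of_lt_left one_pos
  have hsum : Summable fun n => (s - α) * |coeff n v| / gammaWeight s (n + 1) := by
    refine summable_of_succ_add_le (b := fun n => |coeff n v| / gammaWeight s n)
      (q := fun n => |coeff n Q| / gammaWeight s (n + 1)) (N := ⌈|α| + |s|⌉₊)
      (fun n => div_nonneg (abs_nonneg _) (gammaWeight_pos s n).le)
      (fun n => div_nonneg (mul_nonneg (by linarith) (abs_nonneg _)) (gammaWeight_pos s _).le)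
      (fun n => div_nonneg (abs_nonneg _) (gammaWeight_pos s _).le) ?_ ?_
    · refine (hQ.summable.div_const (max 1 (1 + s))).congr fun n => ?_
      rw [gammaWeight_succ', div_div, mul_comm]
    · intro n hn
      have hn' : |α| + |s| ≤ n := Nat.ceil_le.1 hn
      have h1 : 0 ≤ (n : ℝ) + 1 + α := by linarith [neg_abs_le α, abs_nonneg s]
      have h2 : 1 ≤ (n : ℝ) + 1 + s := by linarith [neg_abs_le s, abs_nonneg α]
      have hD : gammaWeight s (n + 1) = gammaWeight s n * (n + 1 + s) := by
        rw [gammaWeight_succ, max_eq_right h2]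
      have hpos := gammaWeight_pos s n
      have h3 : |coeff (n + 1) v| ≤ ((n : ℝ) + 1 + α) * |coeff n v| + |coeff n Q| := by
        rw [hrec]
        refine (abs_add_le _ _).trans (le_of_eq ?_)
        rw [abs_mul, abs_neg, abs_of_nonneg h1]
      have h4 : |coeff n v| / gammaWeight s n =
          ((n : ℝ) + 1 + s) * |coeff n v| / gammaWeight s (n + 1) := by
        rw [hD]
        field_simp
      rw [h4, ← add_div, ← add_div]
      refine div_le_div_of_nonneg_right ?_ (gammaWeight_pos s _).le
      linarith
  refine finiteNorm_of_summable ?_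
  refine (hsum.mul_left (max 1 (1 + s) / (s - α))).congr fun n => ?_
  have : s - α ≠ 0 := by linarith
  rw [gammaWeight_succ']
  field_simp

theorem exists_tendsto_of_summable_abs_sub {u q : ℕ → ℝ} (hq : Summable q)
    (h : ∀ᶠ n in atTop, |u (n + 1) - u n| ≤ q n) : ∃ l, Tendsto u atTop (𝓝 l) := by
  refine cauchySeq_tendsto_of_complete (cauchySeq_of_summable_dist ?_)
  refine Summable.of_norm_bounded_eventually_nat hq ?_
  filter_upwards [h] with n hn
  rwa [Real.norm_of_nonneg dist_nonneg, dist_comm, Real.dist_eq]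

/-- For large `n` the Gamma function is a nonzero constant multiple of the weight. -/
theorem eventually_Gamma_eq_gammaWeight (s : ℝ) :
    ∃ κ : ℝ, ∀ᶠ n : ℕ in atTop, Real.Gamma (n + 1 + s) = κ * gammaWeight s n := by
  set N := ⌈|s|⌉₊ with hN
  refine ⟨Real.Gamma (N + 1 + s) / gammaWeight s N, ?_⟩
  filter_upwards [eventually_ge_atTop N] with n hn
  induction n, hn using Nat.le_induction with
  | base => rw [div_mul_cancel₀ _ (gammaWeight_pos s N).ne']
  | succ n hn ih =>
    have hn' : |s| ≤ n := Nat.ceil_le.1 hn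
    have h2 : 1 ≤ (n : ℝ) + 1 + s := by linarith [neg_abs_le s]
    rw [gammaWeight_succ, max_eq_right h2, ← mul_assoc, ← ih, mul_comm,
      ← Real.Gamma_add_one (by linarith)]
    congr 1
    push_cast
    ring

/-- The normalized coefficients converge when the inhomogeneity of the linear recursion is
summable against `1 / Γ (n + 2 + α)`. -/
theorem exists_tendsto_div_Gamma {α : ℝ} {v Q : ℝ⟦X⟧}
    (hrec : ∀ n : ℕ, coeff (n + 1) v = -((n : ℝ) + 1 + α) * coeff n v + coeff n Q)
    (hQ : FiniteNorm (α + 1) Q) :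
    ∃ S : ℝ, Tendsto (fun n : ℕ => (-1) ^ n * coeff n v / Real.Gamma (n + 1 + α)) atTop (𝓝 S) := by
  have hm : (0 : ℝ) < max 1 (1 + α) := lt_max_of_lt_left one_pos
  obtain ⟨l, hl⟩ : ∃ l, Tendsto (fun n : ℕ => (-1) ^ n * coeff n v / gammaWeight α n)
      atTop (𝓝 l) := by
    refine exists_tendsto_of_summable_abs_sub (hQ.summable.div_const (max 1 (1 + α))) ?_
    filter_upwards [eventually_ge_atTop ⌈|α|⌉₊] with n hn
    have hn' : |α| ≤ n := Nat.ceil_le.1 hn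
    have h2 : 1 ≤ (n : ℝ) + 1 + α := by linarith [neg_abs_le α]
    have hD : gammaWeight α (n + 1) = gammaWeight α n * (n + 1 + α) := by
      rw [gammaWeight_succ, max_eq_right h2]
    have hpos := gammaWeight_pos α n
    have e : (-1) ^ (n + 1) * coeff (n + 1) v / gammaWeight α (n + 1) -
        (-1) ^ n * coeff n v / gammaWeight α n =
        (-1) ^ (n + 1) * coeff n Q / gammaWeight α (n + 1) := by
      rw [hrec, hD, pow_succ]
      field_simp
      ring
    rw [e, abs_div, abs_mul, abs_pow, abs_neg, abs_one, one_pow, one_mul,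
      abs_of_pos (gammaWeight_pos α _), gammaWeight_succ', div_div, mul_comm]
  obtain ⟨κ, hκ⟩ := eventually_Gamma_eq_gammaWeight α
  refine ⟨l / κ, (hl.div_const κ).congr' ?_⟩
  filter_upwards [hκ] with n hn
  rw [hn, div_div, mul_comm κ]

theorem IsBlowupSolution.exists_tendsto {a : ℝ} {c : ℕ → ℕ → ℝ} {K B : ℝ} (hB : 0 ≤ B)
    (hc : ∀ j k, |c j k| ≤ K * B ^ (j + k)) (h11 : c 1 1 = 0) {v : ℝ⟦X⟧}
    (hv : IsBlowupSolution a c v) :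
    ∃ S : ℝ, Tendsto (fun n : ℕ => (-1) ^ n * coeff n v /
      Real.Gamma (n + 1 + (a - c 1 0 * (2 * c 0 2)))) atTop (𝓝 S) := by
  set α : ℝ := a - c 1 0 * (2 * c 0 2) with hα
  have hrec := hv.coeff_succ
  rw [← hα] at hrec
  -- Each unit step lowers the growth exponent of `v` by one, down to `α + 2`.
  have hdown : ∀ q : ℕ, FiniteNorm (α + 2 + q) v → FiniteNorm (α + 2) v := by
    intro q
    induction q with
    | zero => intro h; simpa using h
    | succ q ih =>
      intro h
      refine ih ?_
      have h1 : FiniteNorm (α + 1 + q + 1 + 1) v := by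
        convert h using 1
        push_cast
        ring
      have hq : (0 : ℝ) ≤ q := Nat.cast_nonneg q
      convert finiteNorm_of_recursion (by linarith) hrec
        (hv.finiteNorm_remainder hB hc h11 h1) using 1
      ring
  obtain ⟨s, hs⟩ := hv.exists_finiteNorm hB hc
  obtain ⟨q, hq⟩ := exists_nat_ge (s - α - 2)
  have h2 : FiniteNorm (α + 1 + 1) v := by
    convert hdown q (hs.mono (by linarith)) using 1
    ring
  exact exists_tendsto_div_Gamma hrec (hv.finiteNorm_remainder hB hc h11 h2)

end Asymptotics

/-! ### Cauchy bounds for the Taylor coefficients -/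

section Taylor

theorem HasFPowerSeriesOnBall.norm_iteratedFDeriv_apply_le {E F : Type*} [NormedAddCommGroup E]
    [NormedSpace ℝ E] [NormedAddCommGroup F] [NormedSpace ℝ F] [CompleteSpace F] {f : E → F}
    {p : FormalMultilinearSeries ℝ E F} {x : E} {r : ENNReal} (h : HasFPowerSeriesOnBall f p x r)
    {n : ℕ} {w : Fin n → E} (hw : ∀ i, ‖w i‖ ≤ 1) :
    ‖iteratedFDeriv ℝ n f x w‖ ≤ n.factorial * ‖p n‖ := by
  rw [h.iteratedFDeriv_eq_sum_of_completeSpace]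
  refine (norm_sum_le _ _).trans ?_
  have h1 : ∀ σ ∈ (Finset.univ : Finset (Equiv.Perm (Fin n))), ‖p n fun i => w (σ i)‖ ≤ ‖p n‖ := by
    intro σ _
    refine ((p n).le_opNorm _).trans (mul_le_of_le_one_right (norm_nonneg _) ?_)
    exact Finset.prod_le_one (fun _ _ => norm_nonneg _) fun i _ => hw _
  refine (Finset.sum_le_sum h1).trans (le_of_eq ?_)
  rw [Finset.sum_const, Finset.card_univ, Fintype.card_perm, Fintype.card_fin, nsmul_eq_mul]

/-- Iterated derivatives along the second, then along the first coordinate are iterated Fréchet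
derivatives. -/
theorem exists_iteratedDeriv_eq_iteratedFDeriv {f : ℝ × ℝ → ℝ} (hf : AnalyticAt ℝ f (0, 0))
    (j k : ℕ) : ∃ w : Fin (j + k) → ℝ × ℝ, (∀ i, ‖w i‖ ≤ 1) ∧
      iteratedDeriv j (fun x => iteratedDeriv k (fun y => f (x, y)) 0) 0 =
        iteratedFDeriv ℝ (j + k) f (0, 0) w := by
  obtain ⟨U, hUf, hUo, hU0⟩ := eventually_nhds_iff.1 hf.eventually_analyticAt
  have hU : AnalyticOnNhd ℝ f U := hUf
  have hdiff : ∀ n, ∀ q ∈ U, DifferentiableAt ℝ (iteratedFDeriv ℝ n f) q := fun n q hq =>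
    (hU.iteratedFDeriv n q hq).differentiableAt
  -- Differentiating `iteratedFDeriv n f q w` along a line adds its direction to the vectors `w`.
  have hline : ∀ n (w : Fin n → ℝ × ℝ) (g : ℝ → ℝ × ℝ) (e : ℝ × ℝ) (t : ℝ), HasDerivAt g e t →
      g t ∈ U → deriv (fun s => iteratedFDeriv ℝ n f (g s) w) t =
        iteratedFDeriv ℝ (n + 1) f (g t) (Fin.cons e w) := by
    intro n w g e t hg ht
    have h1 := (hdiff n (g t) ht).hasFDerivAt.comp_hasDerivAt t hg
    have h2 := (ContinuousMultilinearMap.apply ℝ (fun _ : Fin n => ℝ × ℝ) ℝ w).hasFDerivAt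
      (x := iteratedFDeriv ℝ n f (g t)) |>.comp_hasDerivAt t h1
    rw [iteratedFDeriv_succ_apply_left]
    exact h2.deriv
  have hy : ∀ k : ℕ, ∀ q ∈ U, iteratedDeriv k (fun y => f (q.1, y)) q.2 =
      iteratedFDeriv ℝ k f q fun _ => (0, 1) := by
    intro k
    induction k with
    | zero => intro q _; simp
    | succ k ih =>
      intro q hq
      have hg : HasDerivAt (fun y : ℝ => (q.1, y)) ((0 : ℝ), (1 : ℝ)) q.2 :=
        (hasDerivAt_const q.2 q.1).prodMk (hasDerivAt_id q.2)
      have hev : ∀ᶠ y in 𝓝 q.2, (q.1, y) ∈ U :=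
        hg.continuousAt.eventually (hUo.mem_nhds hq)
      rw [iteratedDeriv_succ, Filter.EventuallyEq.deriv_eq (f := fun y =>
        iteratedFDeriv ℝ k f (q.1, y) fun _ => (0, 1))]
      · rw [hline k _ _ _ _ hg hq]
        congr 1
        ext i
        all_goals refine Fin.cases ?_ (fun _ => ?_) i <;> rfl
      · filter_upwards [hev] with y hy
        exact ih (q.1, y) hy
  have hx : ∀ j : ℕ, ∃ w : Fin (j + k) → ℝ × ℝ, (∀ i, ‖w i‖ ≤ 1) ∧ ∀ x : ℝ, (x, (0 : ℝ)) ∈ U →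
      iteratedDeriv j (fun x => iteratedDeriv k (fun y => f (x, y)) 0) x =
        iteratedFDeriv ℝ (j + k) f (x, 0) w := by
    intro j
    induction j with
    | zero =>
      rw [Nat.zero_add]
      refine ⟨fun _ => (0, 1), fun i => by simp [Prod.norm_def], fun x hx => ?_⟩
      rw [iteratedDeriv_zero]
      exact hy k (x, 0) hx
    | succ j ih =>
      obtain ⟨w, hw, ih⟩ := ih
      rw [Nat.add_right_comm]
      refine ⟨Fin.cons (1, 0) w, Fin.cases (by simp [Prod.norm_def]) hw, fun x hx => ?_⟩
      have hg : HasDerivAt (fun t : ℝ => (t, (0 : ℝ))) ((1 : ℝ), (0 : ℝ)) x :=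
        (hasDerivAt_id x).prodMk (hasDerivAt_const x 0)
      have hev : ∀ᶠ t in 𝓝 x, (t, (0 : ℝ)) ∈ U :=
        hg.continuousAt.eventually (hUo.mem_nhds hx)
      rw [iteratedDeriv_succ, Filter.EventuallyEq.deriv_eq (f := fun t =>
        iteratedFDeriv ℝ (j + k) f (t, 0) w), hline (j + k) w _ _ _ hg hx]
      filter_upwards [hev] with t ht
      exact ih t ht
  obtain ⟨w, hw, h⟩ := hx j
  exact ⟨w, hw, h 0 hU0⟩

theorem exists_abs_taylorCoeff₂_le {f : ℝ × ℝ → ℝ} (hf : AnalyticAt ℝ f (0, 0)) :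
    ∃ K B : ℝ, 0 ≤ B ∧ ∀ j k, |taylorCoeff₂ f j k| ≤ K * B ^ (j + k) := by
  obtain ⟨p, r, hp⟩ := hf
  obtain ⟨r', hr0, hr⟩ := ENNReal.lt_iff_exists_nnreal_btwn.1 hp.r_pos
  have hr0' : 0 < r' := by simpa using hr0
  obtain ⟨K, hK, hpK⟩ := p.norm_le_div_pow_of_pos_of_lt_radius hr0' (hr.trans_le hp.r_le)
  have hr1 : (0 : ℝ) < r' := hr0'
  refine ⟨K, 2 / r', by positivity, fun j k => ?_⟩
  obtain ⟨w, hw, h⟩ := exists_iteratedDeriv_eq_iteratedFDeriv ⟨p, r, hp⟩ j k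
  have h1 := hp.norm_iteratedFDeriv_apply_le hw
  rw [Real.norm_eq_abs] at h1
  have hj : (0 : ℝ) < j.factorial := by exact_mod_cast j.factorial_pos
  have hk : (0 : ℝ) < k.factorial := by exact_mod_cast k.factorial_pos
  -- The binomial coefficient is at most `2 ^ (j + k)`.
  have h2 : ((j + k).factorial : ℝ) ≤ 2 ^ (j + k) * (j.factorial * k.factorial) := by
    have h3 := Nat.choose_le_two_pow (j + k) k
    have h4 := Nat.add_choose_mul_factorial_mul_factorial j k
    have h5 : (j + k).factorial ≤ 2 ^ (j + k) * (j.factorial * k.factorial) := by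
      rw [← h4, mul_assoc]
      exact Nat.mul_le_mul_right _ h3
    exact_mod_cast h5
  rw [taylorCoeff₂, h, abs_div, abs_of_pos (mul_pos hj hk), div_le_iff₀ (mul_pos hj hk)]
  calc _ ≤ ((j + k).factorial : ℝ) * ‖p (j + k)‖ := h1
    _ ≤ (2 ^ (j + k) * (j.factorial * k.factorial)) * (K / r' ^ (j + k)) :=
      mul_le_mul h2 (hpK _) (norm_nonneg _) (by positivity)
    _ = _ := by rw [div_pow]; ring

end Taylor

/-! ### The formal center manifold -/

theorem taylorCoeff₂_zero_zero (f : ℝ × ℝ → ℝ) : taylorCoeff₂ f 0 0 = f (0, 0) := by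
  simp [taylorCoeff₂]

theorem taylorCoeff₂_zero_one (f : ℝ × ℝ → ℝ) :
    taylorCoeff₂ f 0 1 = deriv (fun y => f (0, y)) 0 := by
  simp [taylorCoeff₂, iteratedDeriv_one]

theorem taylorCoeff₂_one_one (f : ℝ × ℝ → ℝ) :
    taylorCoeff₂ f 1 1 = deriv (fun x => deriv (fun y => f (x, y)) 0) 0 := by
  simp [taylorCoeff₂, iteratedDeriv_one]

theorem formalInvariant_eq (a : ℝ) (f : ℝ × ℝ → ℝ) :
    formalInvariant a f = a - taylorCoeff₂ f 1 0 * (2 * taylorCoeff₂ f 0 2) := by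
  simp only [formalInvariant, taylorCoeff₂, iteratedDeriv_one, iteratedDeriv_zero,
    Nat.factorial_one, Nat.factorial_zero, Nat.factorial_two]
  push_cast
  ring

theorem isFormalCenterManifold_X_mul_iff {a : ℝ} {f : ℝ × ℝ → ℝ} (hf0 : f (0, 0) = 0)
    (hfy : deriv (fun y => f (0, y)) 0 = 0) (w : ℂ⟦X⟧) :
    IsFormalCenterManifold a f (X * w) ↔
      IsBlowupSolution (a : ℂ) (fun j k => (taylorCoeff₂ f j k : ℂ)) w := by
  rw [← invariance_iff_isBlowupSolution (a : ℂ) (by simp [taylorCoeff₂_zero_zero, hf0])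
    (by simp [taylorCoeff₂_zero_one, hfy])]
  exact and_iff_right (by simp)

theorem mainTheorem1 (a : ℝ) (f : ℝ × ℝ → ℝ) (hf : AnalyticAt ℝ f (0, 0))
    (hf0 : f (0, 0) = 0)
    (hfy : deriv (fun y => f (0, y)) 0 = 0)
    (hfxy : deriv (fun x => deriv (fun y => f (x, y)) 0) 0 = 0) :
    ∃ φ : ℂ⟦X⟧, IsFormalCenterManifold a f φ ∧
      (∀ ψ : ℂ⟦X⟧, IsFormalCenterManifold a f ψ → ψ = φ) ∧
      ∃ S : ℝ, Tendsto
        (fun n : ℕ => (-1 : ℂ) ^ n * PowerSeries.coeff n φ /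
          ((Real.Gamma (n + formalInvariant a f) : ℝ) : ℂ))
        atTop (𝓝 (S : ℂ)) := by
  obtain ⟨v, hv⟩ := exists_isBlowupSolution a (taylorCoeff₂ f)
  have hvC : IsBlowupSolution (a : ℂ) (fun j k => (taylorCoeff₂ f j k : ℂ))
      (PowerSeries.map Complex.ofRealHom v) := hv.map Complex.ofRealHom
  refine ⟨X * PowerSeries.map Complex.ofRealHom v,
    (isFormalCenterManifold_X_mul_iff hf0 hfy _).2 hvC, fun ψ hψ => ?_, ?_⟩
  · obtain ⟨w, rfl⟩ := X_dvd_iff.2 hψ.1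
    rw [((isFormalCenterManifold_X_mul_iff hf0 hfy w).1 hψ).unique hvC]
  · obtain ⟨K, B, hB, hc⟩ := exists_abs_taylorCoeff₂_le hf
    obtain ⟨S, hS⟩ := hv.exists_tendsto hB hc (by rw [taylorCoeff₂_one_one, hfxy])
    rw [← formalInvariant_eq] at hS
    -- The index shift between `φ = x v` and `v` changes the sign of the limit.
    refine ⟨-S, (tendsto_add_atTop_iff_nat 1).1 ?_⟩
    have hS' := (Complex.continuous_ofReal.tendsto _).comp hS.neg
    refine hS'.congr fun n => ?_
    rw [coeff_succ_X_mul, PowerSeries.coeff_map]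
    simp only [Function.comp_apply]
    push_cast
    rw [pow_succ]
    simp only [Complex.ofRealHom_eq_coe]
    ring
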